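/- Consider the difference equation $$x_{n+1}=x_{n-1}e^{a_n-x_{n-1}-x_n},\qquad n=0,1,2,\dots,\tag{E}$$ with initial values $x_{-1},x_0>0$. Suppose that the sequence $\{a_n\}_{n\ge 0}$ of real numbers is periodic with even minimal period $p$ and that $$\sigma=\sum_{j=1}^{p}(-1)^j a_{j-1}=-a_0+a_1-a_2+\cdots+a_{p-1}=0 .$$ Fix a real number $t_0>0$, put $t_n=t_0^{(-1)^n}e^{(-1)^n s_n}$ with $s_n=\sum_{j=1}^{n}(-1)^j a_{j-1}$ for $n\ge 1$, let $g_k(x)=t_kxe^{-x}$, and let $f=g_{p-1}\circ\cdots\circ g_1\circ g_0$, regarded as a map of the interval $(0,\infty)$ into itself. (a) If $s>0$ is a periodic point of $f$ with period $\omega\ge 1$ (that is, $f^{\omega}(s)=s$), then the solution of (E) with initial values $x_{-1}=s$ and $x_0=t_0se^{-s}$ has period $p\omega$; if $\omega$ is the minimal period of $s$, then $p\omega$ is the minimal period of this solution. (b) If $s>0$ is not a periodic point of $f$, then the solution of (E) with $x_{-1}=s$ and $x_0=t_0se^{-s}$ is not periodic; if moreover no iterate $f^m(s)$, $m\ge 0$,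 is a periodic point of $f$, then this solution is not even eventually periodic. In particular, if $f$ has a non-periodic point, then (E) has a non-periodic solution. (c) If $f$ has a point of minimal period three, then for every positive integer $n$ equation (E) has a periodic solution of minimal period $pn$, and (E) has chaotic solutions in the sense of Li and Yorke: there is an uncountable set $S$ of non-periodic positive solutions of (E) such that for all $\{x_n\}\neq\{y_n\}$ in $S$ $$\limsup_{n\to\infty}|x_n-y_n|>0,\qquad \liminf_{n\to\infty}|x_n-y_n|=0,$$ and $\limsup_{n\to\infty}|x_n-y_n|>0$ for every $\{x_n\}\in S$ and every periodic positive solution $\{y_n\}$ of (E). All these solutions (those of period $pn$ and those in $S$) can be taken with initial values on the curve $x_0=t_0x_{-1}e^{-x_{-1}}$. -/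

import Mathlib

/-- `x` is a positive solution of `x_{n+1} = x_{n-1} exp (a_n - x_n - x_{n-1})`, `n = 0, 1, 2, …`,
with initial values `x_{-1}, x_0 > 0`. The index is shifted by one: the term `x_{n-1}` of the
solution is `x n`, so that the initial values are `x_{-1} = x 0` and `x_0 = x 1`. -/
def IsPosSolution (a : ℕ → ℝ) (x : ℕ → ℝ) : Prop :=
  0 < x 0 ∧ 0 < x 1 ∧ ∀ n, x (n + 2) = x n * Real.exp (a n - x (n + 1) - x n)

/-- `p` is a period of the sequence `u` (from its first term on). -/
def HasPeriod (u : ℕ → ℝ) (p : ℕ) : Prop :=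
  0 < p ∧ ∀ n, u (n + p) = u n

/-- `p` is the minimal period of the sequence `u`. -/
def HasMinimalPeriod (u : ℕ → ℝ) (p : ℕ) : Prop :=
  IsLeast {q : ℕ | HasPeriod u q} p

/-- The sequence `u` is periodic. -/
def IsPeriodicSeq (u : ℕ → ℝ) : Prop :=
  ∃ p, HasPeriod u p

/-- The sequence `u` is periodic from some term on. -/
def IsEventuallyPeriodicSeq (u : ℕ → ℝ) : Prop :=
  ∃ m, IsPeriodicSeq fun n => u (n + m)

/-- `s_n = ∑_{j=1}^n (-1)^j a_{j-1}`; for a sequence `a` of period `p`, `σ = s_p`. -/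
def altSum (a : ℕ → ℝ) (n : ℕ) : ℝ :=
  ∑ j ∈ Finset.Icc 1 n, (-1 : ℝ) ^ j * a (j - 1)

/-- `t_n = t₀^{(-1)^n} exp ((-1)^n s_n)`; in particular the term with `n = 0` is `t₀`. -/
noncomputable def factorSeq (a : ℕ → ℝ) (t₀ : ℝ) (n : ℕ) : ℝ :=
  t₀ ^ ((-1 : ℤ) ^ n) * Real.exp ((-1 : ℝ) ^ n * altSum a n)

/-- `g_k(x) = t_k x e^{-x}`. -/
noncomputable def cofactorMap (a : ℕ → ℝ) (t₀ : ℝ) (k : ℕ) (x : ℝ) : ℝ :=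
  factorSeq a t₀ k * x * Real.exp (-x)

/-- The composition `g_{q-1} ∘ ⋯ ∘ g_1 ∘ g_0` of the first `q` maps. -/
noncomputable def intervalMap (a : ℕ → ℝ) (t₀ : ℝ) : ℕ → ℝ → ℝ
  | 0 => id
  | q + 1 => cofactorMap a t₀ q ∘ intervalMap a t₀ q

/-- `S` is an uncountable set of positive solutions which are chaotic in the sense of Li and Yorke:
none of them is periodic, any two of them come arbitrarily close to each other but do
not approach each other, and none of them approaches a periodic solution. The upper and lower
limits are taken in `[0, ∞]`. -/
def IsLiYorkeChaoticSet (a : ℕ → ℝ) (S : Set (ℕ → ℝ)) : Prop :=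
  ¬ S.Countable ∧
  (∀ x ∈ S, IsPosSolution a x ∧ ¬ IsPeriodicSeq x) ∧
  (∀ x ∈ S, ∀ y ∈ S, x ≠ y →
    0 < Filter.limsup (fun n => edist (x n) (y n)) Filter.atTop ∧
    Filter.liminf (fun n => edist (x n) (y n)) Filter.atTop = 0) ∧
  (∀ x ∈ S, ∀ y, IsPosSolution a y → IsPeriodicSeq y →
    0 < Filter.limsup (fun n => edist (x n) (y n)) Filter.atTop)

open Set Filter Topology Function

/-! ### Interval coverings -/

/-! Since `t_{n+1} t_n = e^{a_n}` (`factorSeq_succ_mul`), a solution that starts on the curve `x₀ =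
t₀ x₋₁ e^{-x₋₁}` satisfies the first-order recursion `x_n = t_n x_{n-1} e^{-x_{n-1}}` throughout. As
`p` is even and `σ = 0`, `t_n` has period `p`, so every `p`-th term of the solution is an iterate of
`f` (`intervalMap_mul`). Conversely, a period of a solution is a period of `a`, hence a multiple of
`p`. This gives (a) and (b).

Part (c) is the Li–Yorke theorem for `f` as a continuous map of the line; the points found lie to
the right of the least point of the 3-cycle, hence are positive. Loops of covering intervals give
all periods (`exists_minimalPeriod_eq_of_covers`). For the scrambled set, an iterate `g` of `f` has
a fixed point `z` with a backward orbit decreasing to it. Orbits can then be steered close to `z`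
for longer and longer times and, at the times `k ^ 2`, to a prescribed side of a gap
(`exists_orbits_of_prescribed_sides`); binary sequences encode the sides. -/

lemma exists_Icc_image_eq_of_le {f : ℝ → ℝ} (hf : Continuous f) {x y p q : ℝ} (hxy : x ≤ y)
    (hpq : p ≤ q) (hx : f x = p) (hy : f y = q) :
    ∃ u v, u ≤ v ∧ Icc u v ⊆ Icc x y ∧ f '' Icc u v = Icc p q := by
  -- `u` is the last point with value `p`, `v` the first one after it with value `q`; leaving `[p,
  -- q]` in between would produce another such point.
  have hA : IsCompact (Icc x y ∩ f ⁻¹' {p}) :=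
    isCompact_Icc.inter_right (isClosed_singleton.preimage hf)
  obtain ⟨u, ⟨hu, hup⟩, humax⟩ := hA.exists_isGreatest ⟨x, left_mem_Icc.2 hxy, hx⟩
  have hB : IsCompact (Icc u y ∩ f ⁻¹' {q}) :=
    isCompact_Icc.inter_right (isClosed_singleton.preimage hf)
  obtain ⟨v, ⟨hv, hvq⟩, hvmin⟩ := hB.exists_isLeast ⟨y, right_mem_Icc.2 hu.2, hy⟩
  simp only [mem_preimage, mem_singleton_iff] at hup hvq
  refine ⟨u, v, hv.1, Icc_subset_Icc hu.1 hv.2, Subset.antisymm ?_ ?_⟩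
  · rintro _ ⟨w, hw, rfl⟩
    constructor
    · by_contra! h
      obtain ⟨w', hw', hfw'⟩ : p ∈ f '' Icc w v :=
        intermediate_value_Icc hw.2 hf.continuousOn ⟨h.le, hvq.symm ▸ hpq⟩
      have hle : w' ≤ u := humax ⟨⟨hu.1.trans (hw.1.trans hw'.1), hw'.2.trans hv.2⟩, hfw'⟩
      have : w = u := le_antisymm (hw'.1.trans hle) hw.1
      subst this
      exact h.ne hup
    · by_contra! h
      obtain ⟨w', hw', hfw'⟩ : q ∈ f '' Icc u w :=
        intermediate_value_Icc hw.1 hf.continuousOn ⟨hup.symm ▸ hpq, h.le⟩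
      have hle : v ≤ w' := hvmin ⟨⟨hw'.1, hw'.2.trans (hw.2.trans hv.2)⟩, hfw'⟩
      have : w = v := le_antisymm hw.2 (hle.trans hw'.2)
      subst this
      exact h.ne' hvq
  · have := intermediate_value_Icc hv.1 hf.continuousOn
    rwa [hup, hvq] at this

/-- If `f` maps `[u, v]` over `[p, q]`, then it maps some subinterval exactly onto `[p, q]`. -/
lemma exists_Icc_image_eq {f : ℝ → ℝ} (hf : Continuous f) {u v p q : ℝ} (hpq : p ≤ q)
    (h : Icc p q ⊆ f '' Icc u v) :
    ∃ u' v', u' ≤ v' ∧ Icc u' v' ⊆ Icc u v ∧ f '' Icc u' v' = Icc p q := by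
  obtain ⟨x, hx, hxp⟩ := h (left_mem_Icc.2 hpq)
  obtain ⟨y, hy, hyq⟩ := h (right_mem_Icc.2 hpq)
  rcases le_total x y with hxy | hxy
  · obtain ⟨u', v', h1, h2, h3⟩ := exists_Icc_image_eq_of_le hf hxy hpq hxp hyq
    exact ⟨u', v', h1, h2.trans (Icc_subset_Icc hx.1 hy.2), h3⟩
  · obtain ⟨u', v', h1, h2, h3⟩ := exists_Icc_image_eq_of_le hf.neg hxy (neg_le_neg hpq)
      (congrArg Neg.neg hyq) (congrArg Neg.neg hxp)
    refine ⟨u', v', h1, h2.trans (Icc_subset_Icc hy.1 hx.2), ?_⟩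
    have h4 : Neg.neg '' ((fun x => -f x) '' Icc u' v') = Neg.neg '' Icc (-q) (-p) :=
      congrArg _ h3
    simpa [image_image] using h4

/-- The tail of the itinerary is realised on an interval `[p, q]`, which is then pulled back one
step. The image has to be exactly `[p, q]`, so that every point of the new interval follows the
itinerary. -/
lemma exists_Icc_iterate_image_eq {f : ℝ → ℝ} (hf : Continuous f) (n : ℕ) :
    ∀ u v : ℕ → ℝ, (∀ i, u i ≤ v i) →
      (∀ i < n, Icc (u (i + 1)) (v (i + 1)) ⊆ f '' Icc (u i) (v i)) →
      ∃ u' v', u' ≤ v' ∧ (∀ i ≤ n, ∀ x ∈ Icc u' v', f^[i] x ∈ Icc (u i) (v i)) ∧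
        f^[n] '' Icc u' v' = Icc (u n) (v n) := by
  induction n with
  | zero =>
    intro u v huv _
    refine ⟨u 0, v 0, huv 0, fun i hi x hx => ?_, by simp⟩
    obtain rfl : i = 0 := by omega
    exact hx
  | succ n ih =>
    intro u v huv hcov
    obtain ⟨p, q, hpq, hmem, himg⟩ := ih (fun i => u (i + 1)) (fun i => v (i + 1))
      (fun i => huv _) (fun i hi => hcov (i + 1) (by omega))
    have hsub : Icc p q ⊆ f '' Icc (u 0) (v 0) :=
      fun x hx => hcov 0 (by omega) (hmem 0 (Nat.zero_le _) x hx)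
    obtain ⟨u', v', h1, h2, h3⟩ := exists_Icc_image_eq hf hpq hsub
    refine ⟨u', v', h1, fun i hi x hx => ?_, ?_⟩
    · cases i with
      | zero => exact h2 hx
      | succ i =>
        rw [iterate_succ_apply]
        exact hmem i (by omega) _ (h3 ▸ mem_image_of_mem f hx)
    · rw [iterate_succ, image_comp, h3, himg]

lemma exists_isFixedPt_of_Icc_subset_image {f : ℝ → ℝ} (hf : Continuous f) {u v : ℝ}
    (huv : u ≤ v) (h : Icc u v ⊆ f '' Icc u v) : ∃ x ∈ Icc u v, f x = x := by
  obtain ⟨x, hx, hxu⟩ := h (left_mem_Icc.2 huv)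
  obtain ⟨y, hy, hyv⟩ := h (right_mem_Icc.2 huv)
  have hcont : ContinuousOn (fun x => f x - x) (uIcc x y) := (hf.sub continuous_id).continuousOn
  obtain ⟨w, hw, hfw⟩ : (0 : ℝ) ∈ (fun x => f x - x) '' uIcc x y :=
    intermediate_value_uIcc hcont
      (mem_uIcc.2 (Or.inl ⟨by simp [hxu, hx.1], by simp [hyv, hy.2]⟩))
  exact ⟨w, (uIcc_subset_Icc hx hy) hw, sub_eq_zero.1 hfw⟩

/-- A closed loop of intervals, each of which is mapped over the next one, is followed by a
periodic point. -/
lemma exists_isPeriodicPt_of_loop {f : ℝ → ℝ} (hf : Continuous f) (n : ℕ) (u v : ℕ → ℝ)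
    (huv : ∀ i, u i ≤ v i)
    (hcov : ∀ i < n, Icc (u (i + 1)) (v (i + 1)) ⊆ f '' Icc (u i) (v i))
    (hloop : Icc (u 0) (v 0) ⊆ Icc (u n) (v n)) :
    ∃ x, (∀ i ≤ n, f^[i] x ∈ Icc (u i) (v i)) ∧ IsPeriodicPt f n x := by
  obtain ⟨u', v', h1, h2, h3⟩ := exists_Icc_iterate_image_eq hf n u v huv hcov
  obtain ⟨x, hx, hfx⟩ := exists_isFixedPt_of_Icc_subset_image (hf.iterate n) h1
    (by rw [h3]; exact fun x hx => hloop (h2 0 (Nat.zero_le _) x hx))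
  exact ⟨x, fun i hi => h2 i hi x hx, hfx⟩

/-- A sequence of compact sets, each of which is mapped over the next one, is followed by an
orbit. -/
lemma exists_forall_iterate_mem {f : ℝ → ℝ} (hf : Continuous f) (I : ℕ → Set ℝ)
    (hI : ∀ i, IsCompact (I i)) (hne : ∀ i, (I i).Nonempty)
    (hcov : ∀ i, I (i + 1) ⊆ f '' I i) : ∃ x, ∀ i, f^[i] x ∈ I i := by
  have hfin : ∀ n, ∀ y ∈ I n, ∃ x, f^[n] x = y ∧ ∀ i ≤ n, f^[i] x ∈ I i := by
    intro n
    induction n with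
    | zero =>
      intro y hy
      refine ⟨y, rfl, fun i hi => ?_⟩
      obtain rfl : i = 0 := by omega
      exact hy
    | succ n ih =>
      intro y hy
      obtain ⟨w, hw, rfl⟩ := hcov n hy
      obtain ⟨x, rfl, hx⟩ := ih w hw
      refine ⟨x, iterate_succ_apply' f n x, fun i hi => ?_⟩
      rcases Nat.le_succ_iff.1 hi with hi | rfl
      · exact hx i hi
      · rwa [Nat.succ_eq_add_one, iterate_succ_apply']
  -- Finite itineraries are realised on nested nonempty compact sets, so the infinite one is too.
  let C : ℕ → Set ℝ := fun n => ⋂ i ∈ Iic n, f^[i] ⁻¹' I i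
  have hC : ∀ n, IsClosed (C n) := fun n =>
    isClosed_biInter fun i _ => (hI i).isClosed.preimage (hf.iterate i)
  have hC0 : IsCompact (C 0) :=
    (hI 0).of_isClosed_subset (hC 0) (by simp [C])
  obtain ⟨x, hx⟩ := IsCompact.nonempty_iInter_of_sequence_nonempty_isCompact_isClosed C
    (fun n => biInter_subset_biInter_left (Iic_subset_Iic.2 n.le_succ))
    (fun n => by
      obtain ⟨y, hy⟩ := hne n
      obtain ⟨x, -, hx⟩ := hfin n y hy
      exact ⟨x, mem_iInter₂.2 fun i hi => hx i hi⟩) hC0 hC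
  exact ⟨x, fun i => mem_iInter₂.1 (mem_iInter.1 hx i) i (mem_Iic.2 le_rfl)⟩

/-! ### Period three -/

/-- Follow the loop that stays in `L` for `n - 1` steps and is in `K` at time `n - 1`. If the
minimal period `m` were less than `n`, the point at time `n - 1` would equal the one at time `m -
1`, so lie in `K ∩ L` and be `b`. Then `f b = x`, and `f (f b) = f x` would be in `L`. -/
lemma exists_minimalPeriod_eq_of_covers {f : ℝ → ℝ} (hf : Continuous f) {k₁ k₂ l₁ l₂ b : ℝ}
    (hk : k₁ ≤ k₂) (hl : l₁ ≤ l₂) (hKL : Icc k₁ k₂ ∩ Icc l₁ l₂ ⊆ {b})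
    (hK : Icc l₁ l₂ ⊆ f '' Icc k₁ k₂) (hLK : Icc k₁ k₂ ⊆ f '' Icc l₁ l₂)
    (hL : Icc l₁ l₂ ⊆ f '' Icc l₁ l₂) (hb : f (f b) ∉ Icc l₁ l₂) {n : ℕ} (hn : 0 < n) :
    ∃ x ∈ Icc l₁ l₂, minimalPeriod f x = n := by
  rcases Nat.lt_or_ge 1 n with h1 | h1
  swap
  · obtain ⟨x, hx, hfx⟩ := exists_isFixedPt_of_Icc_subset_image hf hl hL
    refine ⟨x, hx, ?_⟩
    rw [show n = 1 by omega]
    exact minimalPeriod_eq_one_iff_isFixedPt.2 hfx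
  obtain ⟨x, hx, hper⟩ := exists_isPeriodicPt_of_loop hf n
    (fun i => if i = n - 1 then k₁ else l₁) (fun i => if i = n - 1 then k₂ else l₂)
    (fun i => by split_ifs <;> assumption)
    (fun i hi => by
      split_ifs with h2 h3
      · omega
      · exact hLK
      · exact hK
      · exact hL)
    (by
      rw [if_neg (by omega), if_neg (by omega), if_neg (by omega), if_neg (by omega)])
  have hxL : ∀ i < n - 1, f^[i] x ∈ Icc l₁ l₂ := fun i hi => by
    have := hx i (by omega)
    rwa [if_neg (by omega), if_neg (by omega)] at this
  have hxK : f^[n - 1] x ∈ Icc k₁ k₂ := by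
    have := hx (n - 1) (by omega)
    rwa [if_pos rfl, if_pos rfl] at this
  have hx0 : x ∈ Icc l₁ l₂ := hxL 0 (by omega)
  refine ⟨x, hx0, ?_⟩
  set m := minimalPeriod f x with hm
  have hm0 : 0 < m := hper.minimalPeriod_pos hn
  have hdvd : m ∣ n := hper.minimalPeriod_dvd
  by_contra hmn
  have hlt : m < n := lt_of_le_of_ne (Nat.le_of_dvd hn hdvd) hmn
  have hmod : (n - 1) % m = m - 1 := by
    obtain ⟨q, rfl⟩ := hdvd
    obtain ⟨q, rfl⟩ : ∃ q', q = q' + 1 := ⟨q - 1, by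
      have : q ≠ 0 := by rintro rfl; simp at hn
      omega⟩
    have : m * (q + 1) - 1 = m - 1 + m * q := by rw [mul_add, mul_one]; omega
    rw [this, Nat.add_mul_mod_self_left, Nat.mod_eq_of_lt (by omega)]
  have hmem : f^[n - 1] x ∈ Icc l₁ l₂ := by
    rw [← iterate_mod_minimalPeriod_eq, ← hm, hmod]
    exact hxL _ (by omega)
  have hxb : f^[n - 1] x = b := hKL ⟨hxK, hmem⟩
  have hfb : f b = x := by
    rw [← hxb, ← iterate_succ_apply' f, Nat.succ_eq_add_one, Nat.sub_add_cancel hn]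
    exact hper
  apply hb
  rw [hfb]
  rcases Nat.lt_or_ge 1 m with h | h
  · exact hxL 1 (by omega)
  · have : IsFixedPt f x := minimalPeriod_eq_one_iff_isFixedPt.1 (by omega)
    rwa [this]

/-- A point of minimal period three gives rise to a three-cycle with its least point listed
first. -/
lemma exists_least_of_minimalPeriod_eq_three {f : ℝ → ℝ} {s : ℝ} (h : minimalPeriod f s = 3) :
    ∃ m, f (f (f (f^[m] s))) = f^[m] s ∧ f^[m] s < f (f^[m] s) ∧ f^[m] s < f (f (f^[m] s)) ∧
      f (f^[m] s) ≠ f (f (f^[m] s)) := by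
  have h3 : f (f (f s)) = s := by
    have := isPeriodicPt_minimalPeriod f s
    rwa [h] at this
  have h01 : f s ≠ s := fun h' => by
    have := minimalPeriod_eq_one_iff_isFixedPt.2 (show IsFixedPt f s from h')
    omega
  have h12 : f (f s) ≠ f s := fun h' => h01 (by rw [h', h'] at h3; exact h3)
  have h02 : f (f s) ≠ s := fun h' => h01 (by rwa [h'] at h3)
  rcases lt_or_gt_of_ne h01 with a1 | a1 <;> rcases lt_or_gt_of_ne h12 with a2 | a2 <;>
    rcases lt_or_gt_of_ne h02 with a3 | a3
  · exact ⟨2, by simp [h3, a2, a3, h01.symm]⟩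
  · linarith
  · exact ⟨1, by simp [h3, a1, a2, h02]⟩
  · exact ⟨1, by simp [h3, a1, a2, h02]⟩
  · exact ⟨2, by simp [h3, a2, a3, h01.symm]⟩
  · exact ⟨0, by simp [h3, a1, a3, h12.symm]⟩
  · linarith
  · exact ⟨0, by simp [h3, a1, a3, h12.symm]⟩

/-- Period three implies all periods. -/
theorem exists_minimalPeriod_eq_of_three_cycle {f : ℝ → ℝ} (hf : Continuous f) {a : ℝ}
    (h3 : f (f (f a)) = a) (h1 : a < f a) (h2 : a < f (f a)) (h12 : f a ≠ f (f a))
    {n : ℕ} (hn : 0 < n) : ∃ x, a ≤ x ∧ minimalPeriod f x = n := by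
  have hcov : ∀ {x y : ℝ}, x ≤ y → Icc (f x) (f y) ⊆ f '' Icc x y := fun h =>
    intermediate_value_Icc h hf.continuousOn
  have hcov' : ∀ {x y : ℝ}, x ≤ y → Icc (f y) (f x) ⊆ f '' Icc x y := fun h =>
    intermediate_value_Icc' h hf.continuousOn
  rcases lt_or_gt_of_ne h12 with h | h
  -- Here `K = [a, f a]` and `L = [f a, f (f a)]`; in the other order, `K = [f (f a), f a]` and `L =
  -- [a, f (f a)]`.
  · have hc := hcov' h.le
    rw [h3] at hc
    obtain ⟨x, hx, hxn⟩ := exists_minimalPeriod_eq_of_covers hf (b := f a) h1.le h.le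
      (fun x hx => le_antisymm hx.1.2 hx.2.1) (hcov h1.le)
      ((Icc_subset_Icc_right h.le).trans hc) ((Icc_subset_Icc_left h1.le).trans hc)
      (by rw [h3]; exact fun h' => absurd h'.1 (not_le.2 h1)) hn
    exact ⟨x, h1.le.trans hx.1, hxn⟩
  · have hc := hcov' h2.le
    rw [h3] at hc
    have hk := hcov h.le
    rw [h3] at hk
    obtain ⟨x, hx, hxn⟩ := exists_minimalPeriod_eq_of_covers hf (b := f (f a)) h.le h2.le
      (fun x hx => le_antisymm hx.2.2 hx.1.1) hk
      ((Icc_subset_Icc_left h2.le).trans hc) ((Icc_subset_Icc_right h.le).trans hc)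
      (by rw [h3]; exact fun h' => absurd h'.2 (not_le.2 h)) hn
    exact ⟨x, hx.1, hxn⟩

/-! ### Scrambled families of orbits -/

/-- A continuous map with `g b < b` and `d < g d` has a fixed point `z` in `[b, d]` with a
backward orbit which starts at `d` and decreases to `z`. -/
lemma exists_backward_orbit {g : ℝ → ℝ} (hg : Continuous g) {b d : ℝ} (hbd : b < d)
    (hb : g b < b) (hd : d < g d) :
    ∃ z, ∃ w : ℕ → ℝ, b ≤ z ∧ g z = z ∧ w 0 = d ∧ (∀ n, z < w n) ∧ StrictAnti w ∧
      (∀ n, g (w (n + 1)) = w n) ∧ Tendsto w atTop (𝓝 z) := by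
  have hsub : Continuous fun x => g x - x := hg.sub continuous_id
  have hA : IsCompact (Icc b d ∩ (fun x => g x - x) ⁻¹' {0}) :=
    isCompact_Icc.inter_right (isClosed_singleton.preimage hsub)
  have hne : (Icc b d ∩ (fun x => g x - x) ⁻¹' {0}).Nonempty := by
    obtain ⟨x, hx, hgx⟩ : (0 : ℝ) ∈ (fun x => g x - x) '' Icc b d :=
      intermediate_value_Icc hbd.le hsub.continuousOn
        ⟨by simpa using hb.le, by simpa using hd.le⟩
    exact ⟨x, hx, hgx⟩
  obtain ⟨z, ⟨hz, hgz⟩, hzmax⟩ := hA.exists_isGreatest hne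
  replace hgz : g z = z := sub_eq_zero.1 hgz
  -- `z` is the largest fixed point in `[b, d]`. Hence each `x` in `(z, d]` has a preimage in `(z,
  -- x)`, and the limit of successive preimages, being a fixed point, is `z`.
  have habove : ∀ x, z < x → x ≤ d → x < g x := by
    intro x hzx hxd
    by_contra! h
    obtain ⟨y, hy, hgy⟩ : (0 : ℝ) ∈ (fun x => g x - x) '' Icc x d :=
      intermediate_value_Icc hxd hsub.continuousOn ⟨by simpa using h, by simpa using hd.le⟩
    exact absurd (hzmax ⟨⟨(hz.1.trans hzx.le).trans hy.1, hy.2⟩, hgy⟩)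
      (not_le.2 (hzx.trans_le hy.1))
  have hzd : z < d := lt_of_le_of_ne hz.2 fun h => by
    rw [← h, hgz] at hd
    exact hd.false
  have hpre : ∀ x : Ioc z d, ∃ y : Ioc z d, (y : ℝ) < x ∧ g y = x := by
    rintro ⟨x, hzx, hxd⟩
    obtain ⟨y, hy, hgy⟩ : x ∈ g '' Ioo z x :=
      intermediate_value_Ioo hzx.le hg.continuousOn ⟨hgz.symm ▸ hzx, habove x hzx hxd⟩
    exact ⟨⟨y, hy.1, hy.2.le.trans hxd⟩, hy.2, hgy⟩
  choose φ hφ using hpre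
  let W : ℕ → Ioc z d := fun n => φ^[n] ⟨d, hzd, le_rfl⟩
  have hW : ∀ n, W (n + 1) = φ (W n) := fun n => iterate_succ_apply' φ n _
  have hanti : StrictAnti fun n => (W n : ℝ) :=
    strictAnti_nat_of_succ_lt fun n => by rw [hW]; exact (hφ _).1
  have hgW : ∀ n, g (W (n + 1)) = W n := fun n => by rw [hW]; exact (hφ _).2
  have hbdd : BddBelow (range fun n => (W n : ℝ)) :=
    ⟨z, by rintro _ ⟨n, rfl⟩; exact (W n).2.1.le⟩
  have hlim := tendsto_atTop_ciInf hanti.antitone hbdd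
  set ℓ := ⨅ n, (W n : ℝ)
  have hzl : z ≤ ℓ := le_ciInf fun n => (W n).2.1.le
  have hld : ℓ ≤ d := ciInf_le hbdd 0
  have hgl : g ℓ = ℓ := by
    refine tendsto_nhds_unique ?_ hlim
    have := (hg.tendsto ℓ).comp (hlim.comp (tendsto_add_atTop_nat 1))
    refine this.congr fun n => ?_
    exact hgW n
  have hlz : ℓ = z := by
    by_contra h
    exact (habove ℓ (lt_of_le_of_ne hzl (Ne.symm h)) hld).ne' hgl
  refine ⟨z, fun n => W n, hz.1, hgz, rfl, fun n => (W n).2.1, hanti, hgW, ?_⟩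
  rwa [hlz] at hlim

/-- The levels visited at the times `k ^ 2, …, (k + 1) ^ 2 - 1`: first the level `0` or `2`, as
prescribed by `θ k`, then `1`, and then a countdown which ends with `1`. -/
def visitLevel (θ : ℕ → Bool) (n : ℕ) : ℕ :=
  if n = n.sqrt * n.sqrt then (if n = 0 ∨ θ n.sqrt = true then 0 else 2)
  else if n = n.sqrt * n.sqrt + 1 then 1
  else 2 * n.sqrt + 1 - (n - n.sqrt * n.sqrt)

lemma visitLevel_sq (θ : ℕ → Bool) {k : ℕ} (hk : 0 < k) :
    visitLevel θ (k * k) = if θ k = true then 0 else 2 := by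
  simp [visitLevel, Nat.sqrt_eq, hk.ne']

lemma visitLevel_sq_add_one (θ : ℕ → Bool) {k : ℕ} (hk : 0 < k) :
    visitLevel θ (k * k + 1) = 1 := by
  simp [visitLevel, Nat.sqrt_add_eq k (show 1 ≤ k + k by omega)]

lemma visitLevel_sq_add (θ : ℕ → Bool) {k r : ℕ} (hr : 2 ≤ r) (hrk : r ≤ 2 * k) :
    visitLevel θ (k * k + r) = 2 * k + 1 - r := by
  rw [visitLevel, Nat.sqrt_add_eq k (by omega), if_neg (by omega), if_neg (by omega)]
  congr 1
  omega

/-- These are the transitions that the coverings allow: levels `0` and `1` may be followed by any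
level, a higher one only by the next lower. Time `0` is a block by itself, so it needs level `0`
whatever `θ 0` is. -/
lemma visitLevel_succ (θ : ℕ → Bool) (n : ℕ) :
    visitLevel θ n = 0 ∨ visitLevel θ n = 1 ∨ visitLevel θ n = visitLevel θ (n + 1) + 1 := by
  obtain ⟨k, r, hr, rfl⟩ : ∃ k r, r ≤ 2 * k ∧ n = k * k + r :=
    ⟨n.sqrt, n - n.sqrt * n.sqrt, by have := n.sqrt_le_add; omega, by
      have := n.sqrt_le; omega⟩
  rcases Nat.eq_zero_or_pos k with rfl | hk
  · obtain rfl : r = 0 := by omega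
    left
    simp [visitLevel]
  · rcases Nat.lt_or_ge r 2 with h | h
    · interval_cases r
      · rw [add_zero, visitLevel_sq θ hk, visitLevel_sq_add_one θ hk]
        split_ifs <;> simp
      · rw [visitLevel_sq_add_one θ hk]
        simp
    · rw [visitLevel_sq_add θ h hr]
      rcases Nat.lt_or_ge r (2 * k) with h' | h'
      · right; right
        rw [add_assoc, visitLevel_sq_add θ (by omega) (by omega)]
        omega
      · right; left
        omega

/-- A family of orbits indexed by binary sequences: at time `k ^ 2` the orbit is to the right of
`β` or to the left of `α`, as prescribed by the sequence, and afterwards it stays close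
to `z` for a long time. -/
theorem exists_orbits_of_prescribed_sides {g : ℝ → ℝ} (hg : Continuous g) {b d c : ℝ}
    (hbd : b < d) (hdc : d < c) (hb : g b < b) (hd : g d = c) (hc : g c = b) :
    ∃ z α β : ℝ, z < β ∧ α < β ∧ ∃ ε : ℕ → ℝ, Tendsto ε atTop (𝓝 0) ∧
      ∃ s : (ℕ → Bool) → ℝ, ∀ θ, b ≤ s θ ∧
        (∀ k, 0 < k → θ k = true → β ≤ g^[k * k] (s θ)) ∧
        (∀ k, 0 < k → θ k = false → g^[k * k] (s θ) ≤ α) ∧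
        ∀ k r, 2 ≤ r → r ≤ k → |g^[k * k + r] (s θ) - z| ≤ ε k := by
  obtain ⟨z, w, hbz, hgz, hw0, hzw, hanti, hgw, hlim⟩ :=
    exists_backward_orbit hg hbd hb (hd.symm ▸ hdc)
  have hzd : z < d := hw0 ▸ hzw 0
  have hwd : ∀ n, w n ≤ d := fun n => hw0 ▸ hanti.antitone (Nat.zero_le n)
  -- Level `0` is `[d, c]`, level `n + 1` is `[z, w n]`. Levels `0` and `2` are separated by the gap
  -- from `α = w 1` to `β = d`, and a high level means being close to `z`.
  let E : ℕ → Set ℝ := fun n => Nat.casesOn n (Icc d c) fun n => Icc z (w n)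
  have hE : ∀ n, E n ⊆ Icc z c := by
    rintro (_ | n)
    · exact Icc_subset_Icc_left hzd.le
    · exact Icc_subset_Icc_right ((hwd n).trans hdc.le)
  have hcov0 : Icc z c ⊆ g '' E 0 := by
    have := intermediate_value_Icc' hdc.le hg.continuousOn
    rw [hd, hc] at this
    exact (Icc_subset_Icc_left hbz).trans this
  have hcov1 : Icc z c ⊆ g '' E 1 := by
    have := intermediate_value_Icc (hzw 0).le hg.continuousOn
    rwa [hgz, hw0, hd, ← hw0] at this
  have hcov2 : ∀ n, E (n + 1) ⊆ g '' E (n + 2) := fun n => by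
    have := intermediate_value_Icc (hzw (n + 1)).le hg.continuousOn
    rwa [hgz, hgw] at this
  have horbit : ∀ θ, ∃ x, ∀ i, g^[i] x ∈ E (visitLevel θ i) := fun θ => by
    refine exists_forall_iterate_mem hg (fun i => E (visitLevel θ i)) (fun i => ?_)
      (fun i => ?_) (fun i => ?_)
    · cases visitLevel θ i <;> exact isCompact_Icc
    · cases visitLevel θ i with
      | zero => exact nonempty_Icc.2 hdc.le
      | succ n => exact nonempty_Icc.2 (hzw n).le
    · rcases visitLevel_succ θ i with h | h | h
      · rw [h]
        exact (hE _).trans hcov0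
      · rw [h]
        exact (hE _).trans hcov1
      · rw [h]
        cases visitLevel θ (i + 1) with
        | zero => exact (hE 0).trans hcov1
        | succ n => exact hcov2 n
  choose s hs using horbit
  refine ⟨z, w 1, d, hzd, hw0 ▸ hanti zero_lt_one, fun k => w k - z, ?_, s,
    fun θ => ⟨hbz.trans (hE (visitLevel θ 0) (hs θ 0)).1, fun k hk hθ => ?_, fun k hk hθ => ?_,
      fun k r hr hrk => ?_⟩⟩
  · simpa using hlim.sub_const z
  · have := hs θ (k * k)
    rw [visitLevel_sq θ hk, if_pos hθ] at this
    exact this.1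
  · have := hs θ (k * k)
    rw [visitLevel_sq θ hk, if_neg (by simp [hθ])] at this
    exact this.2
  · have := hs θ (k * k + r)
    rw [visitLevel_sq_add θ hr (by omega),
      show 2 * k + 1 - r = (2 * k - r) + 1 by omega] at this
    rw [abs_of_nonneg (sub_nonneg.2 this.1)]
    exact sub_le_sub_right (this.2.trans (hanti.antitone (by omega))) z

lemma HasPeriod.apply_add_mul {u : ℕ → ℝ} {q : ℕ} (h : HasPeriod u q) (n m : ℕ) :
    u (n + q * m) = u n := by
  induction m with
  | zero => rfl
  | succ m ih => rw [mul_add, mul_one, ← add_assoc, h.2, ih]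

/-- A sequence which stays close to `z` for longer and longer times, but is away from `z`
infinitely often, does not approach any periodic sequence. -/
lemma exists_frequently_le_abs_sub_of_isPeriodicSeq {u v : ℕ → ℝ} {z β : ℝ} {ε : ℕ → ℝ}
    (hzβ : z < β) (hε : Tendsto ε atTop (𝓝 0))
    (hclose : ∀ k r, 2 ≤ r → r ≤ k → |u (k * k + r) - z| ≤ ε k)
    (hfar : ∃ᶠ n in atTop, β ≤ u n) (hv : IsPeriodicSeq v) :
    ∃ δ > 0, ∃ᶠ n in atTop, δ ≤ |u n - v n| := by
  obtain ⟨q, hq⟩ := hv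
  by_contra! h
  -- Each value of `v` recurs during a long stay of `u` near `z`, so `v` is constantly `z`; this
  -- contradicts `hfar`.
  have hvz : ∀ n, v n = z := by
    intro n
    refine eq_of_forall_dist_le fun η hη => ?_
    rw [Real.dist_eq]
    obtain ⟨M, hM⟩ := eventually_atTop.1 (h (η / 2) (half_pos hη))
    obtain ⟨k, hk, hkM⟩ := ((hε.eventually (gt_mem_nhds (half_pos hη))).and
      (eventually_ge_atTop (M + q + 2))).exists
    have hkk : k ≤ k * k := Nat.le_mul_self k
    set A := k * k + 2 with hA
    have hle : A ≤ n + q * A := (Nat.le_mul_of_pos_left A hq.1).trans (Nat.le_add_left _ _)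
    -- `A + j` is congruent to `n` modulo `q`; the term `q * A` keeps the subtraction from
    -- truncating.
    set j := (n + q * A - A) % q with hj
    have hjq : j < q := Nat.mod_lt _ hq.1
    have hvj : v (k * k + (2 + j)) = v n := by
      have hdiv := Nat.mod_add_div (n + q * A - A) q
      rw [← hq.apply_add_mul (k * k + (2 + j)) ((n + q * A - A) / q), ← hq.apply_add_mul n A]
      congr 1
      omega
    have h1 := hclose k (2 + j) (by omega) (by omega)
    have h2 := (hM (k * k + (2 + j)) (by omega))
    rw [hvj] at h2
    rw [abs_sub_comm] at h2
    have h3 := abs_sub_le (v n) (u (k * k + (2 + j))) z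
    linarith
  obtain ⟨n, hn, hn'⟩ := (hfar.and_eventually (h (β - z) (sub_pos.2 hzβ))).exists
  rw [hvz n] at hn'
  exact hn'.not_ge ((sub_le_sub_right hn z).trans (le_abs_self _))

lemma exists_scrambled_orbits {g : ℝ → ℝ} (hg : Continuous g) {b d c : ℝ}
    (hbd : b < d) (hdc : d < c) (hb : g b < b) (hd : g d = c) (hc : g c = b) :
    ∃ s : (ℕ → Bool) → ℝ, (∀ η, b ≤ s η) ∧
      (∀ η η', η ≠ η' →
        (∃ δ > 0, ∃ᶠ n in atTop, δ ≤ |g^[n] (s η) - g^[n] (s η')|) ∧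
        ∀ δ > 0, ∃ᶠ n in atTop, |g^[n] (s η) - g^[n] (s η')| < δ) ∧
      ∀ η v, IsPeriodicSeq v → ∃ δ > 0, ∃ᶠ n in atTop, δ ≤ |g^[n] (s η) - v n| := by
  obtain ⟨z, α, β, hzβ, hαβ, ε, hε, s, hs⟩ :=
    exists_orbits_of_prescribed_sides hg hbd hdc hb hd hc
  -- Each bit of `η` recurs infinitely often, which separates distinct sequences forever. The value
  -- `true` at first coordinate `0` brings every orbit to the right of `β` infinitely often.
  let θ : (ℕ → Bool) → ℕ → Bool := fun η k =>
    Nat.casesOn (motive := fun _ => Bool) k.unpair.1 true η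
  have hfreq : ∀ i, ∃ᶠ n in atTop, ∃ k, 0 < k ∧ n = k * k ∧ k.unpair.1 = i := by
    intro i
    refine frequently_atTop.2 fun M => ⟨_, ?_, Nat.pair i (M + 1), ?_, rfl, by simp⟩
    · exact (Nat.le_succ M).trans ((Nat.right_le_pair i (M + 1)).trans (Nat.le_mul_self _))
    · exact (Nat.succ_pos M).trans_le (Nat.right_le_pair i (M + 1))
  refine ⟨fun η => s (θ η), fun η => (hs _).1, fun η η' hne => ⟨?_, fun δ hδ => ?_⟩,
    fun η v hv => ?_⟩
  · obtain ⟨i, hi⟩ := Function.ne_iff.1 hne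
    refine ⟨β - α, sub_pos.2 hαβ, (hfreq (i + 1)).mono ?_⟩
    rintro _ ⟨k, hk, rfl, hki⟩
    have hθ : ∀ η, θ η k = η i := fun η => by simp only [θ, hki]
    have key : ∀ η η', η i = true → η' i = false →
        β - α ≤ g^[k * k] (s (θ η)) - g^[k * k] (s (θ η')) := fun η η' h h' =>
      sub_le_sub ((hs _).2.1 k hk ((hθ η).trans h)) ((hs _).2.2.1 k hk ((hθ η').trans h'))
    rcases h : η i <;> rcases h' : η' i
    · exact absurd (h.trans h'.symm) hi
    · rw [abs_sub_comm]
      exact (key η' η h' h).trans (le_abs_self _)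
    · exact (key η η' h h').trans (le_abs_self _)
    · exact absurd (h.trans h'.symm) hi
  · refine frequently_atTop.2 fun M => ?_
    obtain ⟨k, hk, hkM⟩ := ((hε.eventually (gt_mem_nhds (half_pos hδ))).and
      (eventually_ge_atTop (M + 2))).exists
    refine ⟨k * k + 2, by have := Nat.le_mul_self k; omega, ?_⟩
    have h1 := (hs (θ η)).2.2.2 k 2 le_rfl (by omega)
    have h2 := (hs (θ η')).2.2.2 k 2 le_rfl (by omega)
    rw [abs_sub_comm] at h2
    have h3 := abs_sub_le (g^[k * k + 2] (s (θ η))) z (g^[k * k + 2] (s (θ η')))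
    linarith
  · refine exists_frequently_le_abs_sub_of_isPeriodicSeq hzβ hε (hs (θ η)).2.2.2 ?_ hv
    refine (hfreq 0).mono ?_
    rintro _ ⟨k, hk, rfl, hk0⟩
    exact (hs (θ η)).2.1 k hk (by simp only [θ]; rw [hk0]; rfl)

/-- A three-cycle gives rise to a scrambled family of orbits of an iterate of the map. -/
theorem exists_scrambled_orbits_of_three_cycle {f : ℝ → ℝ} (hf : Continuous f) {a : ℝ}
    (h3 : f (f (f a)) = a) (h1 : a < f a) (h2 : a < f (f a)) (h12 : f a ≠ f (f a)) :
    ∃ N > 0, ∃ s : (ℕ → Bool) → ℝ, (∀ η, a ≤ s η) ∧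
      (∀ η η', η ≠ η' →
        (∃ δ > 0, ∃ᶠ n in atTop, δ ≤ |f^[N * n] (s η) - f^[N * n] (s η')|) ∧
        ∀ δ > 0, ∃ᶠ n in atTop, |f^[N * n] (s η) - f^[N * n] (s η')| < δ) ∧
      ∀ η v, IsPeriodicSeq v → ∃ δ > 0, ∃ᶠ n in atTop, δ ≤ |f^[N * n] (s η) - v n| := by
  have key : ∀ F : ℝ → ℝ, Continuous F → F (F (F a)) = a → a < F a → F a < F (F a) →
      ∃ s : (ℕ → Bool) → ℝ, (∀ η, a ≤ s η) ∧
      (∀ η η', η ≠ η' →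
        (∃ δ > 0, ∃ᶠ n in atTop, δ ≤ |(F^[2])^[n] (s η) - (F^[2])^[n] (s η')|) ∧
        ∀ δ > 0, ∃ᶠ n in atTop, |(F^[2])^[n] (s η) - (F^[2])^[n] (s η')| < δ) ∧
      ∀ η v, IsPeriodicSeq v →
        ∃ δ > 0, ∃ᶠ n in atTop, δ ≤ |(F^[2])^[n] (s η) - v n| := by
    intro F hF h3 h1 h2
    -- With `b = F a` and `c = F (F a)`, the map `F^[2]` sends `b` to `a < b`, `d` to `c` and `c` to
    -- `b`.
    obtain ⟨d, hd, hFd⟩ : F a ∈ F '' Ioo (F a) (F (F a)) :=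
      intermediate_value_Ioo' h2.le hF.continuousOn (by rw [h3]; exact ⟨h1, h2⟩)
    obtain ⟨s, hs, hs'⟩ := exists_scrambled_orbits (hF.iterate 2) (b := F a) (d := d)
      (c := F (F a)) hd.1 hd.2 (by simpa [h3] using h1) (by simp [hFd]) (by simp [h3])
    exact ⟨s, fun η => h1.le.trans (hs η), hs'⟩
  rcases lt_or_gt_of_ne h12 with h | h
  · obtain ⟨s, hs⟩ := key f hf h3 h1 h
    refine ⟨2, two_pos, s, ?_⟩
    simpa only [← iterate_mul] using hs
  -- Passing to `f^[2]` runs through the cycle backwards, which restores the increasing order.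
  · obtain ⟨s, hs⟩ := key (f^[2]) (hf.iterate 2) (by simp [h3]) (by simpa using h2)
      (by simpa [h3] using h)
    refine ⟨4, four_pos, s, ?_⟩
    simpa only [← iterate_mul] using hs

/-! ### The difference equation -/

lemma altSum_succ (a : ℕ → ℝ) (n : ℕ) : altSum a (n + 1) = altSum a n + (-1) ^ (n + 1) * a n := by
  simp [altSum, Finset.sum_Icc_succ_top]

/-- An even shift preserves the signs, so each full period contributes `σ = 0`. -/
lemma altSum_add_period {a : ℕ → ℝ} {p : ℕ} (hp : HasPeriod a p) (hpe : Even p)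
    (hσ : altSum a p = 0) (n : ℕ) : altSum a (n + p) = altSum a n := by
  induction n with
  | zero => rw [zero_add, hσ]; simp [altSum]
  | succ n ih =>
    rw [show n + 1 + p = n + p + 1 by omega, altSum_succ, altSum_succ, ih, hp.2,
      show n + p + 1 = n + 1 + p by omega, pow_add _ _ p, hpe.neg_one_pow, mul_one]

lemma factorSeq_zero (a : ℕ → ℝ) (t₀ : ℝ) : factorSeq a t₀ 0 = t₀ := by
  simp [factorSeq, altSum]

lemma factorSeq_pos (a : ℕ → ℝ) {t₀ : ℝ} (ht₀ : 0 < t₀) (n : ℕ) : 0 < factorSeq a t₀ n :=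
  mul_pos (zpow_pos ht₀ _) (Real.exp_pos _)

lemma factorSeq_succ_mul (a : ℕ → ℝ) {t₀ : ℝ} (ht₀ : 0 < t₀) (n : ℕ) :
    factorSeq a t₀ (n + 1) * factorSeq a t₀ n = Real.exp (a n) := by
  have h1 : t₀ ^ ((-1 : ℤ) ^ (n + 1)) * t₀ ^ ((-1 : ℤ) ^ n) = 1 := by
    rw [← zpow_add₀ ht₀.ne', pow_succ]
    simp
  have h2 : ((-1 : ℝ) ^ n) * (-1) ^ n = 1 := by
    rw [← mul_pow]
    simp
  rw [factorSeq, factorSeq, mul_mul_mul_comm, h1, one_mul, ← Real.exp_add, altSum_succ]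
  congr 1
  rw [pow_succ]
  linear_combination a n * h2

lemma factorSeq_add_period {a : ℕ → ℝ} {p : ℕ} (hp : HasPeriod a p) (hpe : Even p)
    (hσ : altSum a p = 0) (t₀ : ℝ) (n : ℕ) : factorSeq a t₀ (n + p) = factorSeq a t₀ n := by
  simp only [factorSeq, altSum_add_period hp hpe hσ, pow_add, hpe.neg_one_pow, mul_one]

lemma intervalMap_succ (a : ℕ → ℝ) (t₀ : ℝ) (n : ℕ) (s : ℝ) :
    intervalMap a t₀ (n + 1) s = factorSeq a t₀ n * intervalMap a t₀ n s *
      Real.exp (-intervalMap a t₀ n s) := rfl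

lemma intervalMap_one (a : ℕ → ℝ) (t₀ s : ℝ) :
    intervalMap a t₀ 1 s = t₀ * s * Real.exp (-s) := by
  rw [intervalMap_succ, factorSeq_zero]
  rfl

lemma intervalMap_pos (a : ℕ → ℝ) {t₀ : ℝ} (ht₀ : 0 < t₀) {s : ℝ} (hs : 0 < s) (n : ℕ) :
    0 < intervalMap a t₀ n s := by
  induction n with
  | zero => exact hs
  | succ n ih =>
    rw [intervalMap_succ]
    exact mul_pos (mul_pos (factorSeq_pos a ht₀ n) ih) (Real.exp_pos _)

lemma continuous_intervalMap (a : ℕ → ℝ) (t₀ : ℝ) (n : ℕ) : Continuous (intervalMap a t₀ n) := by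
  induction n with
  | zero => exact continuous_id
  | succ n ih =>
    have : Continuous (cofactorMap a t₀ n) := by
      unfold cofactorMap
      fun_prop
    exact this.comp ih

lemma isPosSolution_intervalMap (a : ℕ → ℝ) {t₀ : ℝ} (ht₀ : 0 < t₀) {s : ℝ} (hs : 0 < s) :
    IsPosSolution a fun n => intervalMap a t₀ n s := by
  refine ⟨hs, intervalMap_pos a ht₀ hs 1, fun n => ?_⟩
  rw [sub_sub, add_comm (intervalMap a t₀ (n + 1) s), ← sub_sub, Real.exp_sub, Real.exp_sub,
    ← factorSeq_succ_mul a ht₀ n]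
  simp only [intervalMap_succ, Real.exp_neg]
  field_simp

lemma IsPosSolution.eq_of_initial_eq {a x y : ℕ → ℝ} (hx : IsPosSolution a x)
    (hy : IsPosSolution a y) (h0 : x 0 = y 0) (h1 : x 1 = y 1) : x = y := by
  have key : ∀ n, x n = y n ∧ x (n + 1) = y (n + 1) := by
    intro n
    induction n with
    | zero => exact ⟨h0, h1⟩
    | succ n ih => exact ⟨ih.2, by rw [hx.2.2, hy.2.2, ih.1, ih.2]⟩
  exact funext fun n => (key n).1

lemma IsPosSolution.pos {a x : ℕ → ℝ} (hx : IsPosSolution a x) (n : ℕ) : 0 < x n := by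
  have key : ∀ n, 0 < x n ∧ 0 < x (n + 1) := by
    intro n
    induction n with
    | zero => exact ⟨hx.1, hx.2.1⟩
    | succ n ih => exact ⟨ih.2, by rw [hx.2.2]; exact mul_pos ih.1 (Real.exp_pos _)⟩
  exact (key n).1

/-- Every period of a solution is a period of the coefficients. -/
lemma IsPosSolution.hasPeriod_coeff {a x : ℕ → ℝ} (hx : IsPosSolution a x) {q : ℕ}
    (hq : HasPeriod x q) : HasPeriod a q := by
  refine ⟨hq.1, fun n => ?_⟩
  have h1 := hx.2.2 (n + q)
  rw [show n + q + 2 = n + 2 + q by omega, show n + q + 1 = n + 1 + q by omega, hq.2, hq.2, hq.2,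
    hx.2.2 n] at h1
  have := Real.exp_injective (mul_left_cancel₀ (hx.pos n).ne' h1)
  linarith

lemma HasMinimalPeriod.dvd {u : ℕ → ℝ} {p q : ℕ} (hp : HasMinimalPeriod u p)
    (hq : HasPeriod u q) : p ∣ q := by
  rw [Nat.dvd_iff_mod_eq_zero]
  by_contra h
  refine (Nat.mod_lt q hp.1.1).not_ge (hp.2 ⟨Nat.pos_of_ne_zero h, fun n => ?_⟩)
  rw [← hp.1.apply_add_mul (n + q % p) (q / p), add_assoc, Nat.mod_add_div, hq.2]

section

variable {a : ℕ → ℝ} {p : ℕ} {t₀ : ℝ}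

lemma intervalMap_add_period (hp : HasPeriod a p) (hpe : Even p) (hσ : altSum a p = 0)
    (n : ℕ) (s : ℝ) :
    intervalMap a t₀ (n + p) s = intervalMap a t₀ n (intervalMap a t₀ p s) := by
  induction n with
  | zero => rw [zero_add]; rfl
  | succ n ih =>
    rw [show n + 1 + p = n + p + 1 by omega, intervalMap_succ, intervalMap_succ, ih,
      factorSeq_add_period hp hpe hσ]

lemma intervalMap_add_mul (hp : HasPeriod a p) (hpe : Even p) (hσ : altSum a p = 0)
    (n m : ℕ) (s : ℝ) :
    intervalMap a t₀ (n + p * m) s = intervalMap a t₀ n ((intervalMap a t₀ p)^[m] s) := by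
  induction m generalizing s with
  | zero => rfl
  | succ m ih =>
    rw [mul_add, mul_one, ← add_assoc, intervalMap_add_period hp hpe hσ, ih, iterate_succ_apply]

lemma intervalMap_mul (hp : HasPeriod a p) (hpe : Even p) (hσ : altSum a p = 0)
    (m : ℕ) (s : ℝ) : intervalMap a t₀ (p * m) s = (intervalMap a t₀ p)^[m] s := by
  rw [← zero_add (p * m), intervalMap_add_mul hp hpe hσ]
  rfl

lemma hasPeriod_intervalMap (hp : HasPeriod a p) (hpe : Even p) (hσ : altSum a p = 0) {s : ℝ}
    {ω : ℕ} (hω : 0 < ω) (h : IsPeriodicPt (intervalMap a t₀ p) ω s) :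
    HasPeriod (fun n => intervalMap a t₀ n s) (p * ω) :=
  ⟨Nat.mul_pos hp.1 hω, fun n => by
    dsimp only
    rw [intervalMap_add_mul hp hpe hσ, h]⟩

/-- A period of the solution is a period of `a`, hence of the form `p * m`; at index `0` it says
that the `m`-th iterate fixes `s`. -/
lemma hasMinimalPeriod_intervalMap (hp : HasMinimalPeriod a p) (hpe : Even p)
    (hσ : altSum a p = 0) (ht₀ : 0 < t₀) {s : ℝ} (hs : 0 < s) {ω : ℕ} (hω : 0 < ω)
    (h : minimalPeriod (intervalMap a t₀ p) s = ω) :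
    HasMinimalPeriod (fun n => intervalMap a t₀ n s) (p * ω) := by
  subst h
  refine ⟨hasPeriod_intervalMap hp.1 hpe hσ hω (isPeriodicPt_minimalPeriod _ _),
    fun q hq => ?_⟩
  obtain ⟨m, rfl⟩ := hp.dvd ((isPosSolution_intervalMap a ht₀ hs).hasPeriod_coeff hq)
  have hm : IsPeriodicPt (intervalMap a t₀ p) m s := by
    have : intervalMap a t₀ (0 + p * m) s = s := hq.2 0
    rwa [zero_add, intervalMap_mul hp.1 hpe hσ] at this
  exact Nat.mul_le_mul_left p (hm.minimalPeriod_le (Nat.pos_of_mul_pos_left hq.1))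

/-- If the solution issuing from `s` is eventually periodic, then some iterate of `s` is a
periodic point. -/
lemma iterate_mem_periodicPts_of_hasPeriod (hp : HasPeriod a p) (hpe : Even p)
    (hσ : altSum a p = 0) {s : ℝ} {m q : ℕ}
    (h : HasPeriod (fun n => intervalMap a t₀ (n + m) s) q) :
    (intervalMap a t₀ p)^[m] s ∈ periodicPts (intervalMap a t₀ p) := by
  refine mk_mem_periodicPts h.1 ?_
  have hm : m ≤ p * m := Nat.le_mul_of_pos_left m hp.1
  -- The shift by `p` periods compares the indices `p * m` and `p * (q + m)`, both multiples of `p`.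
  have h1 := h.apply_add_mul (p * m - m) p
  rw [show p * m - m + q * p + m = p * (q + m) by rw [mul_add, mul_comm p q]; omega,
    show p * m - m + m = p * m by omega, intervalMap_mul hp hpe hσ,
    intervalMap_mul hp hpe hσ, iterate_add_apply] at h1
  exact h1

/-- A solution on the curve `x₀ = t₀ x₋₁ exp (-x₋₁)` is determined by its first term. -/
lemma IsPosSolution.eq_intervalMap (ht₀ : 0 < t₀) {s : ℝ} {x : ℕ → ℝ} (hx : IsPosSolution a x)
    (h0 : x 0 = s) (h1 : x 1 = t₀ * s * Real.exp (-s)) :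
    x = fun n => intervalMap a t₀ n s := by
  have hs : 0 < s := h0 ▸ hx.1
  exact hx.eq_of_initial_eq (isPosSolution_intervalMap a ht₀ hs) h0
    (h1.trans (intervalMap_one a t₀ s).symm)

end

/-! ### From sampled times to upper and lower limits -/

lemma HasPeriod.comp_mul {u : ℕ → ℝ} {q : ℕ} (h : HasPeriod u q) (m : ℕ) :
    HasPeriod (fun n => u (m * n)) q :=
  ⟨h.1, fun n => by
    dsimp only
    rw [mul_add, mul_comm m q, h.apply_add_mul]⟩

lemma limsup_edist_pos_of_frequently {u v : ℕ → ℝ} {m : ℕ} (hm : 0 < m)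
    (h : ∃ δ > 0, ∃ᶠ n in atTop, δ ≤ |u (m * n) - v (m * n)|) :
    0 < limsup (fun n => edist (u n) (v n)) atTop := by
  obtain ⟨δ, hδ, h⟩ := h
  refine (ENNReal.ofReal_pos.2 hδ).trans_le (le_limsup_of_frequently_le' ?_)
  refine (tendsto_id.const_mul_atTop' hm).frequently (h.mono fun n hn => ?_)
  rw [edist_dist, Real.dist_eq]
  exact ENNReal.ofReal_le_ofReal hn

lemma liminf_edist_eq_zero_of_frequently {u v : ℕ → ℝ} {m : ℕ} (hm : 0 < m)
    (h : ∀ δ > 0, ∃ᶠ n in atTop, |u (m * n) - v (m * n)| < δ) :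
    liminf (fun n => edist (u n) (v n)) atTop = 0 := by
  refine le_antisymm (ENNReal.le_of_forall_pos_le_add fun δ hδ _ => ?_) zero_le
  rw [zero_add]
  refine liminf_le_of_frequently_le' ?_
  refine (tendsto_id.const_mul_atTop' hm).frequently ((h δ hδ).mono fun n hn => ?_)
  rw [edist_dist, Real.dist_eq, ← ENNReal.ofReal_coe_nnreal]
  exact ENNReal.ofReal_le_ofReal hn.le

/-- Period three of the interval map yields an uncountable scrambled set of solutions. -/
theorem exists_isLiYorkeChaoticSet {a : ℕ → ℝ} {p : ℕ} {t₀ : ℝ} (hp : HasPeriod a p)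
    (hpe : Even p) (hσ : altSum a p = 0) (ht₀ : 0 < t₀) {r : ℝ} (hr : 0 < r)
    (h3 : intervalMap a t₀ p (intervalMap a t₀ p (intervalMap a t₀ p r)) = r)
    (h1 : r < intervalMap a t₀ p r) (h2 : r < intervalMap a t₀ p (intervalMap a t₀ p r))
    (h12 : intervalMap a t₀ p r ≠ intervalMap a t₀ p (intervalMap a t₀ p r)) :
    ∃ S : Set (ℕ → ℝ), IsLiYorkeChaoticSet a S ∧
      ∀ x ∈ S, x 1 = t₀ * x 0 * Real.exp (-x 0) := by
  obtain ⟨N, hN, s, hs, hsep, hper⟩ :=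
    exists_scrambled_orbits_of_three_cycle (continuous_intervalMap a t₀ p) h3 h1 h2 h12
  have hpN : 0 < p * N := Nat.mul_pos hp.1 hN
  let X : (ℕ → Bool) → ℕ → ℝ := fun η n => intervalMap a t₀ n (s η)
  have hX : ∀ η n, (intervalMap a t₀ p)^[N * n] (s η) = X η (p * N * n) := fun η n => by
    rw [mul_assoc]
    exact (intervalMap_mul hp hpe hσ _ _).symm
  simp only [hX] at hsep hper
  have hsol : ∀ η, IsPosSolution a (X η) := fun η =>
    isPosSolution_intervalMap a ht₀ (hr.trans_le (hs η))
  have hlim : ∀ η η', η ≠ η' → 0 < limsup (fun n => edist (X η n) (X η' n)) atTop :=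
    fun η η' h => limsup_edist_pos_of_frequently hpN (hsep η η' h).1
  have hlimper : ∀ η y, IsPeriodicSeq y → 0 < limsup (fun n => edist (X η n) (y n)) atTop := by
    rintro η y ⟨q, hq⟩
    exact limsup_edist_pos_of_frequently hpN (hper η _ ⟨q, hq.comp_mul (p * N)⟩)
  have hinj : Injective X := fun η η' h => by
    by_contra hne
    simpa [h] using hlim η η' hne
  refine ⟨range X, ⟨fun hcount => ?_, ?_, ?_, ?_⟩, ?_⟩
  -- Cantor's diagonal argument for binary sequences.
  · have : Countable (range X) := hcount
    have : Countable (ℕ → Bool) := (rangeFactorization_injective.2 hinj).countable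
    obtain ⟨e, he⟩ := exists_surjective_nat (ℕ → Bool)
    obtain ⟨n, hn⟩ := he fun n => !e n n
    simpa using congrFun hn n
  · rintro _ ⟨η, rfl⟩
    -- A periodic member would have to stay away from itself.
    exact ⟨hsol η, fun h => by simpa using hlimper η _ h⟩
  · rintro _ ⟨η, rfl⟩ _ ⟨η', rfl⟩ hne
    have hne' : η ≠ η' := fun h => hne (congrArg X h)
    exact ⟨hlim η η' hne', liminf_edist_eq_zero_of_frequently hpN (hsep η η' hne').2⟩
  · rintro _ ⟨η, rfl⟩ y - hy
    exact hlimper η y hy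
  · rintro _ ⟨η, rfl⟩
    exact intervalMap_one a t₀ (s η)

theorem mainTheorem5 (a : ℕ → ℝ) (p : ℕ) (hp : HasMinimalPeriod a p) (hpe : Even p)
    (hσ : altSum a p = 0) (t₀ : ℝ) (ht₀ : 0 < t₀) (f : ℝ → ℝ) (hf : f = intervalMap a t₀ p) :
    -- (a) solutions issuing from periodic points of `f`
    (∀ (s : ℝ) (ω : ℕ), 0 < s → 0 < ω →
      ∀ x : ℕ → ℝ, IsPosSolution a x → x 0 = s → x 1 = t₀ * s * Real.exp (-s) →
        (Function.IsPeriodicPt f ω s → HasPeriod x (p * ω)) ∧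
        (Function.minimalPeriod f s = ω → HasMinimalPeriod x (p * ω))) ∧
    -- (b) solutions issuing from non-periodic points of `f`
    (∀ s : ℝ, 0 < s →
      (s ∉ Function.periodicPts f →
        ∃ x : ℕ → ℝ, IsPosSolution a x ∧ x 0 = s ∧ x 1 = t₀ * s * Real.exp (-s) ∧
          ¬ IsPeriodicSeq x) ∧
      ((∀ m : ℕ, f^[m] s ∉ Function.periodicPts f) →
        ∃ x : ℕ → ℝ, IsPosSolution a x ∧ x 0 = s ∧ x 1 = t₀ * s * Real.exp (-s) ∧
          ¬ IsEventuallyPeriodicSeq x)) ∧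
    -- (c) period three
    ((∃ s : ℝ, 0 < s ∧ Function.minimalPeriod f s = 3) →
      (∀ n : ℕ, 0 < n →
        ∃ x : ℕ → ℝ, IsPosSolution a x ∧ x 1 = t₀ * x 0 * Real.exp (-x 0) ∧
          HasMinimalPeriod x (p * n)) ∧
      ∃ S : Set (ℕ → ℝ), IsLiYorkeChaoticSet a S ∧
        ∀ x ∈ S, x 1 = t₀ * x 0 * Real.exp (-x 0)) := by
  subst hf
  refine ⟨fun s ω hs hω x hx h0 h1 => ?_, fun s hs => ⟨fun h => ?_, fun h => ?_⟩, ?_⟩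
  · obtain rfl := hx.eq_intervalMap ht₀ h0 h1
    exact ⟨hasPeriod_intervalMap hp.1 hpe hσ hω,
      hasMinimalPeriod_intervalMap hp hpe hσ ht₀ hs hω⟩
  · refine ⟨_, isPosSolution_intervalMap a ht₀ hs, rfl, intervalMap_one a t₀ s, ?_⟩
    rintro ⟨q, hq⟩
    exact h (iterate_mem_periodicPts_of_hasPeriod hp.1 hpe hσ (m := 0) hq)
  · refine ⟨_, isPosSolution_intervalMap a ht₀ hs, rfl, intervalMap_one a t₀ s, ?_⟩
    rintro ⟨m, q, hq⟩
    exact h m (iterate_mem_periodicPts_of_hasPeriod hp.1 hpe hσ hq)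
  · rintro ⟨s, hs, hs3⟩
    obtain ⟨m, h3, h1, h2, h12⟩ := exists_least_of_minimalPeriod_eq_three hs3
    have hpos : 0 < (intervalMap a t₀ p)^[m] s := by
      rw [← intervalMap_mul hp.1 hpe hσ]
      exact intervalMap_pos a ht₀ hs _
    refine ⟨fun n hn => ?_, exists_isLiYorkeChaoticSet hp.1 hpe hσ ht₀ hpos h3 h1 h2 h12⟩
    obtain ⟨x, hx, hxn⟩ := exists_minimalPeriod_eq_of_three_cycle
      (continuous_intervalMap a t₀ p) h3 h1 h2 h12 hn
    have hx0 : 0 < x := hpos.trans_le hx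
    exact ⟨_, isPosSolution_intervalMap a ht₀ hx0, intervalMap_one a t₀ x,
      hasMinimalPeriod_intervalMap hp hpe hσ ht₀ hx0 hn hxn⟩
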